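/- Let $\mathbb K\in\{\mathbb R,\mathbb C\}$, let $\Omega,\omega$ be non-empty sets, $\nu\colon\omega\to(0,\infty)$, and let $E\neq\{0\}$ be a locally complete locally convex Hausdorff space over $\mathbb K$ (that is, for every non-empty closed, bounded, absolutely convex $D\subset E$ the space $E_D=\bigcup_{n\in\mathbb N}nD$, normed by the gauge of $D$, is a Banach space). Let $G\subset E'$ be a separating linear subspace, i.e. $x=0$ whenever $e'(x)=0$ for all $e'\in G$. Let $\mathcal F(\Omega)\subset\mathbb K^\Omega$ and $\mathcal F(\Omega,E)\subset E^\Omega$ be linear subspaces with locally convex Hausdorff topologies, such that all point evaluations $\delta_x$, $x\in\Omega$, belong to $\mathcal F(\Omega)'$. Write $\mathcal F(\Omega)\varepsilon E=L_e(\mathcal F(\Omega)'_\kappa,E)$, where $\mathcal F(\Omega)'_\kappa$ is the dual with the topology of uniform convergence on absolutely convex compact subsets of $\mathcal F(\Omega)$, and $L_e$ carries the topology of uniform convergence on equicontinuous subsets of $\mathcal F(\Omega)'$. For $u\in\mathcal F(\Omega)\varepsilon E$ let $S(u)\colon\Omega\to E$, $S(u)(x)=u(\delta_x)$. Assume that $\mathcal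 F(\Omega)$ and $\mathcal F(\Omega,E)$ are $\varepsilon$-into-compatible: $S\colon\mathcal F(\Omega)\varepsilon E\to\mathcal F(\Omega,E)$ is a well-defined topological isomorphism onto its range. Let $T^{\mathbb K}\colon\mathcal F(\Omega)\to\mathbb K^\omega$ and $T^E\colon\mathcal F(\Omega,E)\to E^\omega$ be linear maps such that $(T^E,T^{\mathbb K})$ is - consistent: for all $u\in\mathcal F(\Omega)\varepsilon E$ and $x\in\omega$, $S(u)\in\mathcal F(\Omega,E)$, $T^{\mathbb K}_x:=\delta_x\circ T^{\mathbb K}\in\mathcal F(\Omega)'$ and $T^E(S(u))(x)=u(T^{\mathbb K}_x)$; - strong: for all $e'\in E'$, $f\in\mathcal F(\Omega,E)$ and $x\in\omega$, $e'\circ f\in\mathcal F(\Omega)$ and $T^{\mathbb K}(e'\circ f)(x)=e'(T^E(f)(x))$. Let $\mathcal F\nu(\Omega)$ be the space of all $f\in\mathcal F(\Omega)$ with $|f|:=\sup_{x\in\omega}|T^{\mathbb K}(f)(x)|\nu(x)<\infty$. Assume that $(\mathcal F\nu(\Omega),|\cdot|)$ is a Banach space and that its closed unit ball $B$ is a compact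 subset of $\mathcal F(\Omega)$. Let $U\subset\omega$ fix the topology in $\mathcal F\nu(\Omega)$: there is $C>0$ with $|f|\le C\sup_{x\in U}|T^{\mathbb K}(f)(x)|\nu(x)$ for all $f\in\mathcal F\nu(\Omega)$ (where $\sup\emptyset=0$). Put $B^{\circ}=\{y'\in\mathcal F(\Omega)'\mid |y'(f)|\le1\text{ for all }f\in B\}$, $$\mathcal F_\varepsilon\nu(\Omega,E)=\{S(u)\mid u\in\mathcal F(\Omega)\varepsilon E,\ u(B^{\circ})\text{ is bounded in }E\},$$ and let $\mathcal F\nu_G(U,E)_{lb}$ be the set of all $f\colon U\to E$ such that $\{f(x)\nu(x)\mid x\in U\}$ is bounded in $E$ and for every $e'\in G$ there is $f_{e'}\in\mathcal F\nu(\Omega)$ with $T^{\mathbb K}(f_{e'})(x)=e'(f(x))$ for all $x\in U$. Then the restriction map $$R_{U,G}\colon\mathcal F_\varepsilon\nu(\Omega,E)\to\mathcal F\nu_G(U,E)_{lb},\qquad f\mapsto(T^E(f)(x))_{x\in U},$$ is well defined and surjective. -/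

import Mathlib

open scoped Pointwise ComplexOrder

noncomputable section

/-- A locally convex Hausdorff space of `V`-valued functions on `Ω`: a linear subspace of `Ω → V`
with a locally convex Hausdorff topology of its own (in general not the topology of pointwise
convergence). -/
structure LcFunctionSpace (𝕜 : Type*) [RCLike 𝕜] (Ω V : Type*) [AddCommGroup V] [Module 𝕜 V] where
  /-- the underlying linear space of functions -/
  carrier : Submodule 𝕜 (Ω → V)
  /-- the topology of the space -/
  topology : TopologicalSpace carrier
  polynormable : @PolynormableSpace 𝕜 carrier _ _ _ topology
  t2 : @T2Space carrier topology

namespace LcFunctionSpace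

variable {𝕜 : Type*} [RCLike 𝕜] {Ω V : Type*} [AddCommGroup V] [Module 𝕜 V]

/-- The elements of the function space `X`. This type synonym carries the topology of `X`
instead of the topology of pointwise convergence. -/
def Elem (X : LcFunctionSpace 𝕜 Ω V) : Type _ := X.carrier

variable (X : LcFunctionSpace 𝕜 Ω V)

instance : AddCommGroup X.Elem := inferInstanceAs (AddCommGroup X.carrier)
instance : Module 𝕜 X.Elem := inferInstanceAs (Module 𝕜 X.carrier)
instance : TopologicalSpace X.Elem := X.topology
instance : PolynormableSpace 𝕜 X.Elem := X.polynormable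
instance : T2Space X.Elem := X.t2
instance : IsTopologicalAddGroup X.Elem :=
  (PolynormableSpace.withSeminorms 𝕜 X.Elem).topologicalAddGroup
instance : ContinuousSMul 𝕜 X.Elem :=
  (PolynormableSpace.withSeminorms 𝕜 X.Elem).continuousSMul

variable {X}

/-- The function `Ω → V` underlying an element of `X`. -/
def Elem.toFun (f : X.Elem) : Ω → V := Subtype.val (p := fun g => g ∈ X.carrier) f

/-- A function belonging to the carrier of `X`, as an element of `X`. -/
def Elem.mk (f : Ω → V) (hf : f ∈ X.carrier) : X.Elem := (⟨f, hf⟩ : X.carrier)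

end LcFunctionSpace

section LocallyComplete

variable (𝕜 : Type*) [RCLike 𝕜] {E : Type*} [AddCommGroup E] [Module 𝕜 E]

/-- The linear space `E_D = ⋃ n, n D` spanned by a disk `D`. -/
def diskSpan (D : Set E) : Set E := ⋃ n : ℕ, (n : 𝕜) • D

/-- The gauge functional of a disk `D`, which is the norm of `E_D`. -/
def diskGauge (D : Set E) (x : E) : ℝ := sInf {r : ℝ | 0 < r ∧ x ∈ (r : 𝕜) • D}

/-- `E` is locally complete: for every closed disk `D` (nonempty, bounded, absolutely convex,
closed) the space `E_D`, normed by the gauge functional of `D`, is a Banach space, i.e. every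
Cauchy sequence of `E_D` converges in `E_D`. -/
def IsLocallyComplete (E : Type*) [AddCommGroup E] [Module 𝕜 E] [TopologicalSpace E] : Prop :=
  ∀ D : Set E, D.Nonempty → IsClosed D → AbsConvex 𝕜 D → Bornology.IsVonNBounded 𝕜 D →
    ∀ s : ℕ → E, (∀ n, s n ∈ diskSpan 𝕜 D) →
      (∀ ε > 0, ∃ N, ∀ m ≥ N, ∀ n ≥ N, diskGauge 𝕜 D (s m - s n) < ε) →
      ∃ x ∈ diskSpan 𝕜 D, ∀ ε > 0, ∃ N, ∀ n ≥ N, diskGauge 𝕜 D (s n - x) < ε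

end LocallyComplete

/-- A linear subspace `G` of the dual of `E` is separating. -/
def IsSeparating {𝕜 : Type*} [RCLike 𝕜] {E : Type*} [AddCommGroup E] [Module 𝕜 E]
    [TopologicalSpace E] (G : Submodule 𝕜 (E →L[𝕜] 𝕜)) : Prop :=
  ∀ x : E, (∀ e' ∈ G, e' x = 0) → x = 0

section EpsilonProduct

variable (𝕜 : Type*) [RCLike 𝕜] (Y : Type*) [AddCommGroup Y] [Module 𝕜 Y] [TopologicalSpace Y]

/-- The dual `Y'_κ` of `Y` with the topology of uniform convergence on the absolutely convex
compact subsets of `Y`. -/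
abbrev DualKappa : Type _ :=
  UniformConvergenceCLM (RingHom.id 𝕜) 𝕜 {K : Set Y | AbsConvex 𝕜 K ∧ IsCompact K}

/-- A set of functionals on `Y` is equicontinuous. -/
def IsEquicontinuousSet (H : Set (DualKappa 𝕜 Y)) : Prop :=
  Equicontinuous (fun (y' : H) (y : Y) => (y' : DualKappa 𝕜 Y) y)

/-- Schwartz' `ε`-product `Y ε E = L_e(Y'_κ, E)`: the continuous linear operators from `Y'_κ` to
`E`, with the topology of uniform convergence on the equicontinuous subsets of `Y'`. -/
abbrev EpsProd (E : Type*) [AddCommGroup E] [Module 𝕜 E] [TopologicalSpace E] : Type _ :=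
  UniformConvergenceCLM (RingHom.id 𝕜) E {H : Set (DualKappa 𝕜 Y) | IsEquicontinuousSet 𝕜 Y H}

variable {𝕜 Y}

/-- A continuous linear functional on `Y`, as an element of `Y'_κ`. -/
def DualKappa.mk (y' : Y →ₗ[𝕜] 𝕜) (h : Continuous y') : DualKappa 𝕜 Y :=
  UniformConvergenceCLM.ofFun (RingHom.id 𝕜) 𝕜 {K : Set Y | AbsConvex 𝕜 K ∧ IsCompact K} ⟨y', h⟩

end EpsilonProduct

section Families

variable {𝕜 : Type*} [RCLike 𝕜] {Ω ω : Type*}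
  {E : Type*} [AddCommGroup E] [Module 𝕜 E] [TopologicalSpace E]

/-- The point evaluation at `x` as a linear functional on a space of scalar functions. -/
def evalLinear (F : LcFunctionSpace 𝕜 Ω 𝕜) (x : Ω) : F.Elem →ₗ[𝕜] 𝕜 where
  toFun f := f.toFun x
  map_add' _ _ := rfl
  map_smul' _ _ := rfl

/-- All point evaluations belong to the dual of `F`. -/
def HasContinuousEval (F : LcFunctionSpace 𝕜 Ω 𝕜) : Prop :=
  ∀ x : Ω, Continuous (evalLinear F x)

/-- The point evaluation `δ_x` as an element of `F'_κ`. -/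
def pointEval {F : LcFunctionSpace 𝕜 Ω 𝕜} (hδ : HasContinuousEval F) (x : Ω) :
    DualKappa 𝕜 F.Elem :=
  DualKappa.mk (evalLinear F x) (hδ x)

/-- The map `S`, sending `u ∈ F ε E` to the function `x ↦ u (δ_x)`. -/
def epsMap {F : LcFunctionSpace 𝕜 Ω 𝕜} (hδ : HasContinuousEval F) (u : EpsProd 𝕜 F.Elem E) :
    Ω → E :=
  fun x => u (pointEval hδ x)

/-- `F` and `FE` are `ε`-into-compatible: `S : F ε E → FE` is a well-defined (automatically linear)
topological isomorphism onto its range. -/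
def IsEpsIntoCompatible [IsTopologicalAddGroup E] {F : LcFunctionSpace 𝕜 Ω 𝕜}
    (hδ : HasContinuousEval F) (FE : LcFunctionSpace 𝕜 Ω E) : Prop :=
  ∃ hS : ∀ u : EpsProd 𝕜 F.Elem E, epsMap hδ u ∈ FE.carrier,
    Topology.IsEmbedding
      (fun u : EpsProd 𝕜 F.Elem E => LcFunctionSpace.Elem.mk (epsMap hδ u) (hS u))

/-- The linear functional `T_x = δ_x ∘ T` on `F`, for `T : F → 𝕜^ω` linear and `x ∈ ω`. -/
def familyLinear {F : LcFunctionSpace 𝕜 Ω 𝕜} (TK : F.Elem →ₗ[𝕜] (ω → 𝕜)) (x : ω) :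
    F.Elem →ₗ[𝕜] 𝕜 :=
  LinearMap.proj x ∘ₗ TK

/-- `(TE, TK)` is a consistent family for `(F, E)`. -/
def IsConsistentFamily {F : LcFunctionSpace 𝕜 Ω 𝕜} (hδ : HasContinuousEval F)
    {FE : LcFunctionSpace 𝕜 Ω E} (TE : FE.Elem →ₗ[𝕜] (ω → E)) (TK : F.Elem →ₗ[𝕜] (ω → 𝕜)) : Prop :=
  ∀ u : EpsProd 𝕜 F.Elem E, ∃ hu : epsMap hδ u ∈ FE.carrier,
    ∀ x : ω, ∃ hx : Continuous (familyLinear TK x),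
      TE (LcFunctionSpace.Elem.mk (epsMap hδ u) hu) x = u (DualKappa.mk (familyLinear TK x) hx)

/-- `(TE, TK)` is a strong family for `(F, E)`. -/
def IsStrongFamily {F : LcFunctionSpace 𝕜 Ω 𝕜} {FE : LcFunctionSpace 𝕜 Ω E}
    (TE : FE.Elem →ₗ[𝕜] (ω → E)) (TK : F.Elem →ₗ[𝕜] (ω → 𝕜)) : Prop :=
  ∀ (e' : E →L[𝕜] 𝕜) (f : FE.Elem), ∃ hf : e' ∘ f.toFun ∈ F.carrier,
    ∀ x : ω, TK (LcFunctionSpace.Elem.mk (e' ∘ f.toFun) hf) x = e' (TE f x)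

end Families

section WeightedSpace

variable {𝕜 : Type*} [RCLike 𝕜] {Ω ω : Type*} {F : LcFunctionSpace 𝕜 Ω 𝕜}

/-- The linear subspace of all `f ∈ F` with `sup_{x ∈ ω} |T f (x)| ν(x) < ∞`. -/
def weightedSubmodule (TK : F.Elem →ₗ[𝕜] (ω → 𝕜)) (ν : ω → Set.Ioi (0 : ℝ)) :
    Submodule 𝕜 F.Elem where
  carrier := {f | BddAbove (Set.range fun x => ‖TK f x‖ * (ν x : ℝ))}
  add_mem' := by
    rintro f g ⟨a, ha⟩ ⟨b, hb⟩
    refine ⟨a + b, ?_⟩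
    rintro _ ⟨x, rfl⟩
    have h1 : ‖TK f x‖ * (ν x : ℝ) ≤ a := ha ⟨x, rfl⟩
    have h2 : ‖TK g x‖ * (ν x : ℝ) ≤ b := hb ⟨x, rfl⟩
    have h3 : ‖TK f x + TK g x‖ * (ν x : ℝ) ≤ (‖TK f x‖ + ‖TK g x‖) * (ν x : ℝ) :=
      mul_le_mul_of_nonneg_right (norm_add_le _ _) (ν x).2.le
    simp only [map_add, Pi.add_apply]
    linarith
  zero_mem' := ⟨0, by rintro _ ⟨x, rfl⟩; simp⟩
  smul_mem' := by
    rintro c f ⟨a, ha⟩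
    refine ⟨‖c‖ * a, ?_⟩
    rintro _ ⟨x, rfl⟩
    have h1 : ‖TK f x‖ * (ν x : ℝ) ≤ a := ha ⟨x, rfl⟩
    simp only [map_smul, Pi.smul_apply, smul_eq_mul, norm_mul, mul_assoc]
    exact mul_le_mul_of_nonneg_left h1 (norm_nonneg _)

/-- The weighted space `Fν(Ω)` generated by `T` and `ν`. This type synonym carries the topology
of the seminorm `|f| = sup_{x ∈ ω} |T f (x)| ν(x)`, not the one inherited from `F`. -/
def WeightedSpace (TK : F.Elem →ₗ[𝕜] (ω → 𝕜)) (ν : ω → Set.Ioi (0 : ℝ)) : Type _ :=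
  weightedSubmodule TK ν

namespace WeightedSpace

variable (TK : F.Elem →ₗ[𝕜] (ω → 𝕜)) (ν : ω → Set.Ioi (0 : ℝ))

instance instAddCommGroup : AddCommGroup (WeightedSpace TK ν) :=
  inferInstanceAs (AddCommGroup (weightedSubmodule TK ν))
instance instModule : Module 𝕜 (WeightedSpace TK ν) :=
  inferInstanceAs (Module 𝕜 (weightedSubmodule TK ν))

/-- The inclusion `Fν(Ω) → F(Ω)`. -/
def incl : WeightedSpace TK ν →ₗ[𝕜] F.Elem := (weightedSubmodule TK ν).subtype

variable {TK ν}

theorem bddAbove (f : WeightedSpace TK ν) :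
    BddAbove (Set.range fun x => ‖TK (incl TK ν f) x‖ * (ν x : ℝ)) :=
  Subtype.property (p := fun g => g ∈ weightedSubmodule TK ν) f

theorem weighted_nonneg (f : WeightedSpace TK ν) (x : ω) :
    0 ≤ ‖TK (incl TK ν f) x‖ * (ν x : ℝ) :=
  mul_nonneg (norm_nonneg _) (ν x).2.le

variable (TK ν)

/-- The seminorm `|f| = sup_{x ∈ ω} |T f (x)| ν(x)` on `Fν(Ω)`. -/
def supSeminorm : Seminorm 𝕜 (WeightedSpace TK ν) :=
  Seminorm.ofSMulLE (fun f => ⨆ x, ‖TK (incl TK ν f) x‖ * (ν x : ℝ))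
    (by simp)
    (by
      intro f g
      refine Real.iSup_le (fun x => ?_)
        (add_nonneg (Real.iSup_nonneg (weighted_nonneg f)) (Real.iSup_nonneg (weighted_nonneg g)))
      have h1 := le_ciSup (bddAbove f) x
      have h2 := le_ciSup (bddAbove g) x
      have h3 : ‖TK (incl TK ν f) x + TK (incl TK ν g) x‖ * (ν x : ℝ)
          ≤ (‖TK (incl TK ν f) x‖ + ‖TK (incl TK ν g) x‖) * (ν x : ℝ) :=
        mul_le_mul_of_nonneg_right (norm_add_le _ _) (ν x).2.le
      simp only [map_add, Pi.add_apply]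
      linarith)
    (by
      intro c f
      refine Real.iSup_le (fun x => ?_)
        (mul_nonneg (norm_nonneg _) (Real.iSup_nonneg (weighted_nonneg f)))
      simp only [map_smul, Pi.smul_apply, smul_eq_mul, norm_mul, mul_assoc]
      exact mul_le_mul_of_nonneg_left (le_ciSup (bddAbove f) x) (norm_nonneg _))

instance instSeminormedAddCommGroup : SeminormedAddCommGroup (WeightedSpace TK ν) :=
  { (supSeminorm TK ν).toSeminormedAddCommGroup with
    toAddCommGroup := instAddCommGroup TK ν }

theorem norm_eq (f : WeightedSpace TK ν) :
    ‖f‖ = ⨆ x, ‖TK (incl TK ν f) x‖ * (ν x : ℝ) := rfl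

instance instNormedSpace : NormedSpace 𝕜 (WeightedSpace TK ν) where
  norm_smul_le c f := ((supSeminorm TK ν).smul' c f).le

/-- The closed unit ball of `Fν(Ω)`, as a subset of `F(Ω)`. -/
def unitBall : Set F.Elem := incl TK ν '' Metric.closedBall 0 1

/-- The polar in `F(Ω)'` of the closed unit ball of `Fν(Ω)`. -/
def unitBallPolar : Set (DualKappa 𝕜 F.Elem) := {y' | ∀ f ∈ unitBall TK ν, ‖y' f‖ ≤ 1}

/-- `U ⊆ ω` fixes the topology in `Fν(Ω)`. -/
def FixesTopology (U : Set ω) : Prop :=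
  ∃ C > 0, ∀ f : WeightedSpace TK ν, ‖f‖ ≤ C * ⨆ x : U, ‖TK (incl TK ν f) x‖ * (ν x : ℝ)

end WeightedSpace

end WeightedSpace

section Restriction

variable {𝕜 : Type*} [RCLike 𝕜] {Ω ω : Type*}
  {E : Type*} [AddCommGroup E] [Module 𝕜 E] [TopologicalSpace E] {F : LcFunctionSpace 𝕜 Ω 𝕜}

/-- The space `F_ε ν(Ω, E)`, the image under `S` of all `u ∈ F ε E` that are bounded on the polar
of the unit ball of `Fν(Ω)`, as a subset of `FE`. -/
def epsWeightedSpace (hδ : HasContinuousEval F) (TK : F.Elem →ₗ[𝕜] (ω → 𝕜))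
    (ν : ω → Set.Ioi (0 : ℝ)) (FE : LcFunctionSpace 𝕜 Ω E) : Set FE.Elem :=
  {f | ∃ u : EpsProd 𝕜 F.Elem E,
    Bornology.IsVonNBounded 𝕜 (u '' WeightedSpace.unitBallPolar TK ν) ∧ epsMap hδ u = f.toFun}

/-- The restriction space `Fν_G(U, E)`: the functions `f : U → E` such that for every `e' ∈ G` there
is `f_{e'} ∈ Fν(Ω)` with `T (f_{e'}) = e' ∘ f` on `U`. -/
def restrictionSpace (TK : F.Elem →ₗ[𝕜] (ω → 𝕜)) (ν : ω → Set.Ioi (0 : ℝ)) (U : Set ω)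
    (G : Submodule 𝕜 (E →L[𝕜] 𝕜)) : Set (U → E) :=
  {f | ∀ e' ∈ G, ∃ fe' : WeightedSpace TK ν, ∀ x : U, TK (WeightedSpace.incl TK ν fe') x = e' (f x)}

/-- The `lb`-restriction space `Fν_G(U, E)_lb`: the `f ∈ Fν_G(U, E)` for which
`{f(x) ν(x) | x ∈ U}` is bounded in `E`. -/
def lbRestrictionSpace (TK : F.Elem →ₗ[𝕜] (ω → 𝕜)) (ν : ω → Set.Ioi (0 : ℝ)) (U : Set ω)
    (G : Submodule 𝕜 (E →L[𝕜] 𝕜)) : Set (U → E) :=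
  {f | f ∈ restrictionSpace TK ν U G ∧
    Bornology.IsVonNBounded 𝕜 (Set.range fun x : U => ((ν x : ℝ) : 𝕜) • f x)}

/-- The restriction map `f ↦ (TE f (x))_{x ∈ U}`. -/
def restrictionMap {FE : LcFunctionSpace 𝕜 Ω E} (TE : FE.Elem →ₗ[𝕜] (ω → E)) (U : Set ω)
    (f : FE.Elem) : U → E :=
  fun x => TE f x

end Restriction

end

/-! ### Absolutely convex sets: hulls and Hahn–Banach separation. -/

section AbsConvex

variable {𝕜 : Type*} [RCLike 𝕜] {V : Type*} [AddCommGroup V] [Module 𝕜 V]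

/-! That restriction lands in the target space is direct: `ν(x) T_x` lies in `B°`, and `e' ∘ S(u)`
serves as `f_{e'}`. For surjectivity, given `f`, the operator `u` is forced: `u(y')` must be the
vector `e` with `e'(e) = y'(f_{e'})` for all `e' ∈ G`. Since `G` separates points, there is at most
one such `e`, and linearity of `u` follows from uniqueness. What has to be shown is that `e` exists
and stays in a bounded set while `y'` runs through `B°`.

Because `U` fixes the topology, a bipolar argument shows that `C` times the disk generated by the
`ν(x) T_x`, `x ∈ U`, is dense in `B°` for uniform convergence on `B`
(`exists_mem_forall_norm_sub_le`). Compactness of `B` enters by identifying the functionals on the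
dual that are bounded on `B°` with points of multiples of `B`
(`exists_mem_forall_eq_apply_of_isCompact`). Approximating `y'` up to `1/2`, doubling the remainder
and repeating gives `y' = C ∑ 2⁻ⁿ aₙ` on `Fν(Ω)`. The same absolutely convex combinations of the
`ν(x) f(x)` give vectors `dₙ` in a closed bounded disk, and local completeness provides `e = C ∑ 2⁻ⁿ
dₙ` (`exists_mem_smul_forall_apply_eq`). So `u(B°)` is bounded, and `u` is continuous on `F(Ω)'_κ`
because `B` is a compact disk. -/

theorem absConvex_of_smul_add_smul_mem {V : Type*} [AddCommMonoid V] [Module 𝕜 V] {s : Set V}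
    (h : ∀ x ∈ s, ∀ y ∈ s, ∀ a b : 𝕜, ‖a‖ + ‖b‖ ≤ 1 → a • x + b • y ∈ s) : AbsConvex 𝕜 s := by
  refine ⟨?_, ?_⟩
  · intro a ha _ hx
    obtain ⟨x, hx, rfl⟩ := hx
    simpa using h x hx x hx a 0 (by simpa using ha)
  · intro x hx y hy a b ha hb hab
    refine h x hx y hy a b ?_
    obtain ⟨a, ha', rfl⟩ := RCLike.nonneg_iff_exists_ofReal.mp ha
    obtain ⟨b, hb', rfl⟩ := RCLike.nonneg_iff_exists_ofReal.mp hb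
    rw [RCLike.norm_of_nonneg ha', RCLike.norm_of_nonneg hb']
    exact_mod_cast hab.le

theorem AbsConvex.linearMap_image {V W : Type*} [AddCommMonoid V] [Module 𝕜 V] [AddCommMonoid W]
    [Module 𝕜 W] {s : Set V} (hs : AbsConvex 𝕜 s) (f : V →ₗ[𝕜] W) :
    AbsConvex 𝕜 (f '' s) := by
  refine ⟨?_, hs.2.linear_image f⟩
  rintro a ha _ ⟨_, ⟨x, hx, rfl⟩, rfl⟩
  exact ⟨a • x, hs.1.smul_mem ha hx, map_smul f a x⟩

theorem AbsConvex.linearMap_preimage {V W : Type*} [AddCommMonoid V] [Module 𝕜 V]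
    [AddCommMonoid W] [Module 𝕜 W] {s : Set W} (hs : AbsConvex 𝕜 s) (f : V →ₗ[𝕜] W) :
    AbsConvex 𝕜 (f ⁻¹' s) := by
  refine ⟨?_, hs.2.linear_preimage f⟩
  rintro a ha _ ⟨x, hx, rfl⟩
  rw [Set.mem_preimage, map_smul]
  exact hs.1.smul_mem ha hx

/-- Convexity with weights `a / (a + b)` and `b / (a + b)`; if both coefficients vanish, any point
of `s` works. -/
theorem AbsConvex.exists_add_eq_smul {s : Set V} (hs : AbsConvex 𝕜 s) {x y : V} (hx : x ∈ s)
    (hy : y ∈ s) {a b : ℝ} (ha : 0 ≤ a) (hb : 0 ≤ b) :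
    ∃ z ∈ s, (a : 𝕜) • x + (b : 𝕜) • y = ((a + b : ℝ) : 𝕜) • z := by
  rcases (add_nonneg ha hb).eq_or_lt with h | h
  · have ha' : a = 0 := by linarith
    have hb' : b = 0 := by linarith
    exact ⟨x, hx, by simp [ha', hb']⟩
  · have h' : ((a : 𝕜) + (b : 𝕜)) ≠ 0 := by exact_mod_cast h.ne'
    refine ⟨((a / (a + b) : ℝ) : 𝕜) • x + ((b / (a + b) : ℝ) : 𝕜) • y, hs.2 hx hy ?_ ?_ ?_, ?_⟩
    · exact_mod_cast div_nonneg ha h.le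
    · exact_mod_cast div_nonneg hb h.le
    · rw [← RCLike.ofReal_add, ← add_div, div_self h.ne', RCLike.ofReal_one]
    · rw [smul_add, smul_smul, smul_smul]
      push_cast
      rw [mul_div_cancel₀ _ h', mul_div_cancel₀ _ h']

/-- The closed disk generated by a bounded set is bounded. -/
theorem Bornology.IsVonNBounded.closedAbsConvexHull [TopologicalSpace V] [PolynormableSpace 𝕜 V]
    {s : Set V} (hs : Bornology.IsVonNBounded 𝕜 s) :
    Bornology.IsVonNBounded 𝕜 (_root_.closedAbsConvexHull 𝕜 s) := by
  have hp := PolynormableSpace.withSeminorms 𝕜 V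
  rw [hp.isVonNBounded_iff_seminorm_bounded] at hs ⊢
  intro p
  obtain ⟨r, hr, h⟩ := hs p
  -- The closed disk `{p ≤ r}` contains the hull; the criterion asks for a strict bound, hence `r +
  -- 1`.
  refine ⟨r + 1, by linarith, fun x hx => ?_⟩
  have : _root_.closedAbsConvexHull 𝕜 s ⊆ {x | p.1 x ≤ r} := by
    refine closedAbsConvexHull_min (fun x hx => (h x hx).le) ?_
      (isClosed_le p.2 continuous_const)
    refine absConvex_of_smul_add_smul_mem fun x hx y hy a b hab => ?_
    simp only [Set.mem_ofPred_eq] at hx hy ⊢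
    refine (map_add_le_add p.1 _ _).trans ?_
    rw [map_smul_eq_mul, map_smul_eq_mul]
    nlinarith [norm_nonneg a, norm_nonneg b]
  have h2 : p.1 x ≤ r := this hx
  linarith

/-- A point outside a closed disk is separated from it by a continuous functional. -/
theorem AbsConvex.exists_separating [TopologicalSpace V] [IsTopologicalAddGroup V]
    [ContinuousSMul 𝕜 V] [Module ℝ V] [IsScalarTower ℝ 𝕜 V] [LocallyConvexSpace ℝ V] {s : Set V}
    (hs : AbsConvex 𝕜 s) (hne : s.Nonempty) (hcl : IsClosed s) {z : V} (hz : z ∉ s) :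
    ∃ f : V →L[𝕜] 𝕜, (∀ x ∈ s, ‖f x‖ ≤ 1) ∧ 1 < ‖f z‖ := by
  obtain ⟨f, u, hu, hzu⟩ := RCLike.geometric_hahn_banach_closed_point (𝕜 := 𝕜)
    (hs.2.lift ℝ) hcl hz
  -- Separation only controls real parts; rotating `x` inside the balanced set `s` turns this into a
  -- bound on the norm.
  have hf : ∀ x ∈ s, ‖f x‖ < u := by
    intro x hx
    obtain ⟨c, hc, hcx⟩ := RCLike.exists_norm_eq_mul_self (f x)
    have := hu (c • x) (hs.1.smul_mem hc.le hx)
    rw [map_smul, smul_eq_mul, ← hcx, RCLike.ofReal_re] at this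
    exact this
  have hu0 : 0 < u := by
    obtain ⟨x, hx⟩ := hne
    exact (norm_nonneg _).trans_lt (hf x hx)
  have hnorm : ∀ x, ‖((u⁻¹ : ℝ) : 𝕜) • f x‖ = u⁻¹ * ‖f x‖ := fun x => by
    rw [norm_smul, RCLike.norm_of_nonneg (inv_nonneg.2 hu0.le)]
  refine ⟨((u⁻¹ : ℝ) : 𝕜) • f, fun x hx => ?_, ?_⟩
  · rw [smul_apply, hnorm, inv_mul_le_iff₀ hu0, mul_one]
    exact (hf x hx).le
  · rw [smul_apply, hnorm, lt_inv_mul_iff₀ hu0, mul_one]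
    exact hzu.trans_le (RCLike.re_le_norm _)

/-- Stated with a closure because the image of a disk of functionals in a function space need not be
closed. -/
theorem AbsConvex.exists_separating_of_normedSpace {Z : Type*} [SeminormedAddCommGroup Z]
    [NormedSpace 𝕜 Z] {s : Set Z} (hs : AbsConvex 𝕜 s) (hne : s.Nonempty) {z : Z}
    (hz : z ∉ _root_.closure s) : ∃ f : Z →L[𝕜] 𝕜, (∀ x ∈ s, ‖f x‖ ≤ 1) ∧ 1 < ‖f z‖ := by
  let _ : NormedSpace ℝ Z := NormedSpace.restrictScalars ℝ 𝕜 Z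
  have : IsScalarTower ℝ 𝕜 Z := RestrictScalars.isScalarTower ℝ 𝕜 Z
  obtain ⟨f, hf, hfz⟩ := hs.closure.exists_separating hne.closure isClosed_closure hz
  exact ⟨f, fun x hx => hf x (subset_closure hx), hfz⟩

end AbsConvex

/-! ### Bipolar arguments for a compact unit ball. -/

section Duality

variable {𝕜 : Type*} [RCLike 𝕜] {Y : Type*} [AddCommGroup Y] [Module 𝕜 Y]

variable {X : Type*} [SeminormedAddCommGroup X] [NormedSpace 𝕜 X]

theorem absConvex_image_closedBall (i : X →ₗ[𝕜] Y) :
    AbsConvex 𝕜 (i '' Metric.closedBall 0 1) := by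
  refine AbsConvex.linearMap_image (absConvex_of_smul_add_smul_mem ?_) i
  intro x hx y hy a b hab
  simp only [mem_closedBall_zero_iff] at hx hy ⊢
  refine (norm_add_le _ _).trans ?_
  rw [norm_smul, norm_smul]
  nlinarith [norm_nonneg a, norm_nonneg b]

variable [TopologicalSpace Y]

/-- A functional on the dual of `Y` that is bounded by `1` on the polar of a compact disk `B` is
the evaluation at a point of `B`. -/
theorem exists_mem_forall_eq_apply_of_isCompact {B : Set Y} (hB : IsCompact B)
    (hBc : AbsConvex 𝕜 B) (hBne : B.Nonempty) (φ : (Y →L[𝕜] 𝕜) →ₗ[𝕜] 𝕜)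
    (hφ : ∀ y' : Y →L[𝕜] 𝕜, (∀ b ∈ B, ‖y' b‖ ≤ 1) → ‖φ y'‖ ≤ 1) :
    ∃ b ∈ B, ∀ y', φ y' = y' b := by
  classical
  -- By compactness it suffices to represent `φ` on finitely many functionals at a time.
  have key := hB.inter_iInter_nonempty (fun y' : Y →L[𝕜] 𝕜 => {b : Y | φ y' = y' b})
    (fun y' => isClosed_eq continuous_const y'.continuous) (fun s => ?_)
  · obtain ⟨b, hb, h⟩ := key
    exact ⟨b, hb, fun y' => Set.mem_iInter.mp h y'⟩
  · let T : Y →L[𝕜] (s → 𝕜) := ContinuousLinearMap.pi fun j => (j : Y →L[𝕜] 𝕜)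
    by_cases hmem : (fun j : s => φ j) ∈ T '' B
    · obtain ⟨b, hb, h⟩ := hmem
      refine ⟨b, hb, Set.mem_iInter₂.2 fun y' hy' => ?_⟩
      exact (congrFun h ⟨y', hy'⟩).symm
    · exfalso
      -- A functional on `𝕜^s` separating the values of `φ` from `T '' B` is a linear combination of
      -- coordinates. The same combination of the members of `s` lies in the polar of `B`, yet `φ`
      -- exceeds `1` there.
      obtain ⟨f, hf1, hf2⟩ := (hBc.linearMap_image (T : Y →ₗ[𝕜] (s → 𝕜))).exists_separating
        (hBne.image _) (hB.image T.continuous).isClosed hmem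
      have hf : ∀ z : s → 𝕜, f z = ∑ j, z j * f (fun k => if j = k then 1 else 0) := fun z => by
        simpa [smul_eq_mul] using LinearMap.pi_apply_eq_sum_univ (f : (s → 𝕜) →ₗ[𝕜] 𝕜) z
      let y' : Y →L[𝕜] 𝕜 := ∑ j : s, f (fun k => if j = k then 1 else 0) • (j : Y →L[𝕜] 𝕜)
      have h1 : ∀ b, y' b = f (T b) := fun b => by
        rw [hf]
        simp only [y', sum_apply, smul_apply, smul_eq_mul]
        exact Finset.sum_congr rfl fun j _ => mul_comm _ _
      have h2 : φ y' = f (fun j : s => φ j) := by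
        rw [hf]
        simp only [y', map_sum, map_smul, smul_eq_mul]
        exact Finset.sum_congr rfl fun j _ => mul_comm _ _
      have h3 := hφ y' fun b hb => by
        rw [h1]
        exact hf1 _ ⟨b, hb, rfl⟩
      rw [h2] at h3
      linarith

/-- If a disk `A` of functionals determines the norm of `X` up to a constant `C`, then each linear
map `J` bounded by `1` on the polar of the unit ball of `X` sends this polar to the closure of
`C • J '' A`. -/
theorem mem_closure_image_smul_of_forall_norm_le (i : X →ₗ[𝕜] Y)
    (hB : IsCompact (i '' Metric.closedBall 0 1)) {A : Set (Y →L[𝕜] 𝕜)} (hA : AbsConvex 𝕜 A)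
    (hAne : A.Nonempty) {C : ℝ} (hC : 0 < C)
    (hAC : ∀ f : X, (∀ a ∈ A, ‖a (i f)‖ ≤ 1) → ‖f‖ ≤ C) {Z : Type*} [SeminormedAddCommGroup Z]
    [NormedSpace 𝕜 Z] (J : (Y →L[𝕜] 𝕜) →ₗ[𝕜] Z)
    (hJ : ∀ y : Y →L[𝕜] 𝕜, (∀ b ∈ i '' Metric.closedBall 0 1, ‖y b‖ ≤ 1) → ‖J y‖ ≤ 1)
    {y' : Y →L[𝕜] 𝕜} (hy' : ∀ b ∈ i '' Metric.closedBall 0 1, ‖y' b‖ ≤ 1) :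
    J y' ∈ closure (⇑((C : 𝕜) • J : (Y →L[𝕜] 𝕜) →ₗ[𝕜] Z) '' A) := by
  by_contra hmem
  obtain ⟨f, hf1, hf2⟩ := (hA.linearMap_image
    ((C : 𝕜) • J : (Y →L[𝕜] 𝕜) →ₗ[𝕜] Z)).exists_separating_of_normedSpace
    (hAne.image _) hmem
  -- Dividing by `R` makes `f ∘ J` bounded by `1` on the polar, so it is an evaluation at a point of
  -- the ball; `+ 1` keeps `R` positive.
  set R : ℝ := ‖f‖ + 1
  have hR0 : 0 < R := by positivity
  have hR0' : (R : 𝕜) ≠ 0 := by exact_mod_cast hR0.ne'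
  let φ : (Y →L[𝕜] 𝕜) →ₗ[𝕜] 𝕜 :=
    { toFun := fun y => ((R⁻¹ : ℝ) : 𝕜) * f (J y)
      map_add' := fun y z => by rw [map_add, map_add, mul_add]
      map_smul' := fun c y => by
        rw [map_smul, map_smul, smul_eq_mul, RingHom.id_apply, smul_eq_mul, mul_left_comm] }
  have hφ : ∀ y : Y →L[𝕜] 𝕜, (∀ b ∈ i '' Metric.closedBall 0 1, ‖y b‖ ≤ 1) → ‖φ y‖ ≤ 1 := by
    intro y hy
    have h1 : ‖J y‖ ≤ 1 := hJ y hy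
    have h2 : ‖f (J y)‖ ≤ R := by
      refine (f.le_opNorm _).trans ?_
      nlinarith [norm_nonneg f]
    change ‖((R⁻¹ : ℝ) : 𝕜) * f (J y)‖ ≤ 1
    rw [norm_mul, RCLike.norm_of_nonneg (inv_nonneg.2 hR0.le), inv_mul_le_iff₀ hR0, mul_one]
    exact h2
  obtain ⟨_, ⟨x, hx, rfl⟩, hxφ⟩ := exists_mem_forall_eq_apply_of_isCompact hB
    (absConvex_image_closedBall i) ⟨i 0, 0, by simp, rfl⟩ φ hφ
  have hxf : ∀ y, f (J y) = y (i ((R : 𝕜) • x)) := fun y => by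
    have : ((R⁻¹ : ℝ) : 𝕜) * f (J y) = y (i x) := hxφ y
    rw [map_smul, map_smul, ← this]
    push_cast
    rw [smul_eq_mul, mul_inv_cancel_left₀ hR0']
  -- Since `A` determines the norm up to `C`, the bound of `f` on `C • J '' A` puts `R • x` in the
  -- unit ball, contradicting `1 < ‖f (J y')‖`.
  have h1 : ‖(C : 𝕜) • (R : 𝕜) • x‖ ≤ C := hAC _ fun a ha => by
    have := hf1 _ ⟨a, ha, rfl⟩
    rw [LinearMap.smul_apply, map_smul, hxf] at this
    rwa [map_smul, map_smul]
  rw [norm_smul, RCLike.norm_of_nonneg hC.le] at h1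
  have h2 : ‖(R : 𝕜) • x‖ ≤ 1 := by
    by_contra! h
    nlinarith
  have h3 := hy' _ ⟨(R : 𝕜) • x, by simpa using h2, rfl⟩
  rw [← hxf] at h3
  linarith

/-- If a disk `A` of functionals determines the norm of `X` up to a constant `C`, then `C • A` is
dense in the polar of the unit ball of `X`, for uniform convergence on this ball. -/
theorem exists_mem_forall_norm_sub_le (i : X →ₗ[𝕜] Y)
    (hB : IsCompact (i '' Metric.closedBall 0 1)) {A : Set (Y →L[𝕜] 𝕜)} (hA : AbsConvex 𝕜 A)
    (hAne : A.Nonempty) {C : ℝ} (hC : 0 < C)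
    (hAC : ∀ f : X, (∀ a ∈ A, ‖a (i f)‖ ≤ 1) → ‖f‖ ≤ C) {y' : Y →L[𝕜] 𝕜}
    (hy' : ∀ b ∈ i '' Metric.closedBall 0 1, ‖y' b‖ ≤ 1) {ε : ℝ} (hε : 0 < ε) :
    ∃ a ∈ A, ∀ b ∈ i '' Metric.closedBall 0 1, ‖y' b - (C : 𝕜) * a b‖ ≤ ε := by
  set B : Set Y := i '' Metric.closedBall 0 1
  have : CompactSpace B := isCompact_iff_compactSpace.mp hB
  -- Restriction to `B`: the sup norm of `C(B, 𝕜)` encodes uniform convergence on `B`.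
  let J : (Y →L[𝕜] 𝕜) →ₗ[𝕜] C(B, 𝕜) :=
    { toFun := fun y => ⟨fun b => y b, by fun_prop⟩
      map_add' := fun _ _ => rfl
      map_smul' := fun _ _ => rfl }
  obtain ⟨_, ⟨a, ha, rfl⟩, hd⟩ := Metric.mem_closure_iff.mp
    (mem_closure_image_smul_of_forall_norm_le i hB hA hAne hC hAC J
      (fun y hy => (ContinuousMap.norm_le _ zero_le_one).2 fun b => hy b b.2) hy') ε hε
  refine ⟨a, ha, fun b hb => ?_⟩
  rw [dist_eq_norm] at hd
  exact ((J y' - (C : 𝕜) • J a).norm_coe_le_norm ⟨b, hb⟩).trans hd.le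

end Duality

/-! ### Geometric series in locally complete spaces. -/

section LocallyComplete

variable {𝕜 : Type*} [RCLike 𝕜] {E : Type*} [AddCommGroup E] [Module 𝕜 E]

theorem diskGauge_le {D : Set E} {r : ℝ} (hr : 0 < r) {x : E} (hx : x ∈ (r : 𝕜) • D) :
    diskGauge 𝕜 D x ≤ r :=
  csInf_le ⟨0, fun _ h => h.1.le⟩ ⟨hr, hx⟩

/-- Membership in some `n • D` is essential: off the span of `D` the gauge is the infimum of the
empty set, which defaults to `0`. -/
theorem exists_mem_smul_of_diskGauge_lt {D : Set E} {x : E} {n : ℕ} (hn : 0 < n)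
    (hx : x ∈ (n : 𝕜) • D) {ε : ℝ} (h : diskGauge 𝕜 D x < ε) :
    ∃ r : ℝ, 0 < r ∧ r < ε ∧ x ∈ (r : 𝕜) • D := by
  obtain ⟨r, ⟨hr, hxr⟩, hlt⟩ := exists_lt_of_csInf_lt
    (s := {r : ℝ | 0 < r ∧ x ∈ (r : 𝕜) • D})
    ⟨(n : ℝ), by exact_mod_cast hn, by simpa using hx⟩ h
  exact ⟨r, hr, hlt, hxr⟩

theorem AbsConvex.smul_subset_smul {D : Set E} (hD : AbsConvex 𝕜 D) {a b : 𝕜} (h : ‖a‖ ≤ ‖b‖) :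
    a • D ⊆ b • D :=
  hD.1.smul_mono h

theorem AbsConvex.add_mem_smul {D : Set E} (hD : AbsConvex 𝕜 D) {x y : E} {a b : ℝ} (ha : 0 ≤ a)
    (hb : 0 ≤ b) (hx : x ∈ (a : 𝕜) • D) (hy : y ∈ (b : 𝕜) • D) :
    x + y ∈ ((a + b : ℝ) : 𝕜) • D := by
  obtain ⟨x, hx, rfl⟩ := hx
  obtain ⟨y, hy, rfl⟩ := hy
  obtain ⟨z, hz, h⟩ := hD.exists_add_eq_smul hx hy ha hb
  exact ⟨z, hz, h.symm⟩

theorem AbsConvex.neg_mem_smul {D : Set E} (hD : AbsConvex 𝕜 D) {x : E} {a : 𝕜}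
    (hx : x ∈ a • D) : -x ∈ a • D := by
  obtain ⟨x, hx, rfl⟩ := hx
  exact ⟨-x, hD.1.neg_mem_iff.2 hx, by simp⟩

/-- The factor is the exact sum of the coefficients, so the induction closes without loss. -/
theorem AbsConvex.sum_Ico_geometric_mem {D : Set E} (hD : AbsConvex 𝕜 D) {d : ℕ → E}
    (hd : ∀ n, d n ∈ D) (N k : ℕ) :
    ∑ n ∈ Finset.Ico N (N + k), (((1 / 2) ^ n : ℝ) : 𝕜) • d n ∈
      ((2 * (1 / 2) ^ N - 2 * (1 / 2) ^ (N + k) : ℝ) : 𝕜) • D := by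
  induction k with
  | zero =>
    simp only [add_zero, Finset.Ico_self, Finset.sum_empty, sub_self, RCLike.ofReal_zero]
    exact ⟨d 0, hd 0, by simp⟩
  | succ k ih =>
    rw [← add_assoc, Finset.sum_Ico_succ_top (by omega)]
    have h1 : ((1 / 2 : ℝ)) ^ (N + k) ≤ (1 / 2) ^ N :=
      pow_le_pow_of_le_one (by norm_num) (by norm_num) (by omega)
    have := hD.add_mem_smul (by linarith) (by positivity) ih
      (Set.smul_mem_smul_set (a := (((1 / 2) ^ (N + k) : ℝ) : 𝕜)) (hd (N + k)))
    convert this using 3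
    ring

variable [TopologicalSpace E]

/-- In a locally complete space, the series `∑ 2⁻ⁿ dₙ` converges weakly for all sequences `d` in a
closed bounded disk. -/
theorem IsLocallyComplete.exists_tendsto_sum_geometric (hE : IsLocallyComplete 𝕜 E) {D : Set E}
    (hcl : IsClosed D) (hD : AbsConvex 𝕜 D) (hbdd : Bornology.IsVonNBounded 𝕜 D) {d : ℕ → E}
    (hd : ∀ n, d n ∈ D) :
    ∃ x ∈ (3 : 𝕜) • D, ∀ e' : E →L[𝕜] 𝕜, Filter.Tendsto
      (fun N => ∑ n ∈ Finset.range N, (((1 / 2) ^ n : ℝ) : 𝕜) * e' (d n)) Filter.atTop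
      (nhds (e' x)) := by
  have hdiff : ∀ N M, N ≤ M → ∑ n ∈ Finset.range M, (((1 / 2) ^ n : ℝ) : 𝕜) • d n -
      ∑ n ∈ Finset.range N, (((1 / 2) ^ n : ℝ) : 𝕜) • d n ∈ ((2 * (1 / 2) ^ N : ℝ) : 𝕜) • D := by
    intro N M hNM
    obtain ⟨k, rfl⟩ := Nat.exists_eq_add_of_le hNM
    rw [← Finset.sum_Ico_eq_sub _ hNM]
    refine hD.smul_subset_smul ?_ (hD.sum_Ico_geometric_mem hd N k)
    have h1 : ((1 / 2 : ℝ)) ^ (N + k) ≤ (1 / 2) ^ N :=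
      pow_le_pow_of_le_one (by norm_num) (by norm_num) (by omega)
    have h2 : (0 : ℝ) < (1 / 2) ^ (N + k) := by positivity
    rw [RCLike.norm_of_nonneg (by linarith), RCLike.norm_of_nonneg (by linarith)]
    linarith
  set s : ℕ → E := fun N => ∑ n ∈ Finset.range N, (((1 / 2) ^ n : ℝ) : 𝕜) • d n with hs
  have hs2 : ∀ N, s N ∈ ((2 : ℝ) : 𝕜) • D := fun N => by
    simpa [s] using hdiff 0 N (Nat.zero_le N)
  have hlim : Filter.Tendsto (fun N => 2 * (1 / 2 : ℝ) ^ N) Filter.atTop (nhds 0) := by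
    simpa using (tendsto_pow_atTop_nhds_zero_of_lt_one (r := (1 / 2 : ℝ)) (by norm_num)
      (by norm_num)).const_mul 2
  obtain ⟨x, hxs, hx⟩ := hE D ⟨d 0, hd 0⟩ hcl hD hbdd s
    (fun N => Set.mem_iUnion.2 ⟨2, by exact_mod_cast hs2 N⟩) (by
      intro ε hε
      obtain ⟨N, hN⟩ := ((hlim.eventually_lt_const hε).exists)
      refine ⟨N, fun m hm n hn => ?_⟩
      have hpow : ∀ k, N ≤ k → 2 * (1 / 2 : ℝ) ^ k ≤ 2 * (1 / 2) ^ N := fun k hk =>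
        mul_le_mul_of_nonneg_left (pow_le_pow_of_le_one (by norm_num) (by norm_num) hk) (by norm_num)
      refine lt_of_le_of_lt (diskGauge_le (by positivity) ?_) hN
      rcases le_total n m with h | h
      · refine hD.smul_subset_smul ?_ (hdiff n m h)
        rw [RCLike.norm_of_nonneg (by positivity), RCLike.norm_of_nonneg (by positivity)]
        exact hpow n hn
      · have := hD.neg_mem_smul (hdiff m n h)
        rw [neg_sub] at this
        refine hD.smul_subset_smul ?_ this
        rw [RCLike.norm_of_nonneg (by positivity), RCLike.norm_of_nonneg (by positivity)]
        exact hpow m hm)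
  obtain ⟨k, hk⟩ := Set.mem_iUnion.1 hxs
  have hclose : ∀ ε > 0, ∃ N, ∀ n ≥ N, ∃ r : ℝ, 0 < r ∧ r < ε ∧ s n - x ∈ (r : 𝕜) • D := by
    intro ε hε
    obtain ⟨N, hN⟩ := hx ε hε
    refine ⟨N, fun n hn => exists_mem_smul_of_diskGauge_lt (n := 2 + k) (by omega) ?_ (hN n hn)⟩
    have := hD.add_mem_smul (a := 2) (b := k) (by norm_num) (by positivity) (hs2 n)
      (hD.neg_mem_smul (by simpa using hk))
    rw [sub_eq_add_neg]
    exact_mod_cast this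
  refine ⟨x, ?_, fun e' => ?_⟩
  -- `3 = 2 + 1`: partial sums lie in `2 • D`, and one of them is within gauge `1` of `x`.
  · obtain ⟨N, hN⟩ := hclose 1 one_pos
    obtain ⟨r, hr0, hr1, hr⟩ := hN N le_rfl
    have h1 := hD.add_mem_smul (a := 2) zero_le_two hr0.le (hs2 N) (hD.neg_mem_smul hr)
    rw [show s N + -(s N - x) = x by abel] at h1
    refine hD.smul_subset_smul ?_ h1
    rw [RCLike.norm_of_nonneg (by linarith)]
    simp only [RCLike.norm_ofNat]
    linarith
  -- Gauge convergence implies weak convergence because `e'` is bounded on `D`.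
  · obtain ⟨M, hM⟩ : ∃ M : ℝ, ∀ e ∈ D, ‖e' e‖ ≤ M := by
      obtain ⟨M, hM⟩ := ((NormedSpace.isVonNBounded_iff 𝕜).1 (hbdd.image e')).exists_norm_le
      exact ⟨M, fun e he => hM _ ⟨e, he, rfl⟩⟩
    have hM0 : 0 ≤ M := (norm_nonneg _).trans (hM _ (hd 0))
    rw [Metric.tendsto_atTop]
    intro ε hε
    obtain ⟨N, hN⟩ := hclose (ε / (M + 1)) (by positivity)
    refine ⟨N, fun n hn => ?_⟩
    obtain ⟨r, hr0, hr1, e, he, hre⟩ := hN n hn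
    have h1 : ∑ n ∈ Finset.range n, (((1 / 2) ^ n : ℝ) : 𝕜) * e' (d n) - e' x = (r : 𝕜) * e' e := by
      have : e' (s n - x) = (r : 𝕜) * e' e := by
        rw [← hre]
        simp
      rw [← this, map_sub, hs]
      simp [map_sum]
    rw [dist_eq_norm, h1, norm_mul, RCLike.norm_of_nonneg hr0.le]
    rw [lt_div_iff₀ (by positivity)] at hr1
    nlinarith [hM e he, norm_nonneg (e' e)]

end LocallyComplete
-- Simultaneous approximation of functionals and vectors.
section Factorization

variable {𝕜 : Type*} [RCLike 𝕜] {X Y E : Type*} [SeminormedAddCommGroup X] [NormedSpace 𝕜 X]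
  [AddCommGroup Y] [Module 𝕜 Y] [TopologicalSpace Y] [AddCommGroup E] [Module 𝕜 E]
  [TopologicalSpace E]

/-- Let `Γ` be a disk of pairs of functionals and vectors whose first components determine the norm
of `X` up to a constant and whose second components lie in a closed bounded disk `D`. Then each
functional in the polar of the unit ball of `X` is matched by a vector in a multiple of `D`, with
respect to all `e'` and `f` which agree on the pairs in `Γ`. -/
theorem exists_mem_smul_forall_apply_eq (hE : IsLocallyComplete 𝕜 E) {D : Set E}
    (hcl : IsClosed D) (hD : AbsConvex 𝕜 D) (hbdd : Bornology.IsVonNBounded 𝕜 D)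
    (i : X →ₗ[𝕜] Y) (hB : IsCompact (i '' Metric.closedBall 0 1)) {Γ : Set ((Y →L[𝕜] 𝕜) × E)}
    (hΓ : AbsConvex 𝕜 Γ) (hΓne : Γ.Nonempty) (hΓD : ∀ p ∈ Γ, p.2 ∈ D) {C : ℝ} (hC : 0 < C)
    (hΓC : ∀ f : X, (∀ p ∈ Γ, ‖p.1 (i f)‖ ≤ 1) → ‖f‖ ≤ C) {y' : Y →L[𝕜] 𝕜}
    (hy' : ∀ b ∈ i '' Metric.closedBall 0 1, ‖y' b‖ ≤ 1) :
    ∃ e ∈ (C : 𝕜) • (3 : 𝕜) • D, ∀ (e' : E →L[𝕜] 𝕜) (f : X),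
      (∀ p ∈ Γ, e' p.2 = p.1 (i f)) → e' e = y' (i f) := by
  let P := {y : Y →L[𝕜] 𝕜 // ∀ b ∈ i '' Metric.closedBall 0 1, ‖y b‖ ≤ 1}
  -- Error `1/2` is what lets the doubled remainder return to the polar, so the step can be
  -- iterated.
  have step : ∀ y : P, ∃ p ∈ Γ, ∃ z : P, z.1 = (2 : 𝕜) • (y.1 - (C : 𝕜) • p.1) := by
    intro y
    obtain ⟨_, ⟨p, hp, rfl⟩, h⟩ := exists_mem_forall_norm_sub_le i hB
      (hΓ.linearMap_image (LinearMap.fst 𝕜 (Y →L[𝕜] 𝕜) E)) (hΓne.image _) hC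
      (fun f hf => hΓC f fun p hp => hf _ ⟨p, hp, rfl⟩) y.2 (ε := 1 / 2) (by norm_num)
    refine ⟨p, hp, ⟨(2 : 𝕜) • (y.1 - (C : 𝕜) • p.1), fun b hb => ?_⟩, rfl⟩
    have := h b hb
    simp only [LinearMap.fst_apply] at this
    simp only [smul_apply, sub_apply, smul_eq_mul, norm_mul, RCLike.norm_ofNat]
    linarith
  choose p hpΓ z hz using step
  let y : ℕ → P := fun n => z^[n] ⟨y', hy'⟩
  have hy : ∀ n, (y (n + 1)).1 = (2 : 𝕜) • ((y n).1 - (C : 𝕜) • (p (y n)).1) := fun n => by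
    rw [← hz]
    exact congrArg Subtype.val (Function.iterate_succ_apply' z n _)
  obtain ⟨x, hxD, hx⟩ := hE.exists_tendsto_sum_geometric hcl hD hbdd
    (d := fun n => (p (y n)).2) fun n => hΓD _ (hpΓ _)
  refine ⟨(C : 𝕜) • x, Set.smul_mem_smul_set hxD, fun e' f hf => ?_⟩
  -- Unrolling the recursion telescopes; the remainder tends to `0` because every `y N` lies in the
  -- polar.
  have hsum : ∀ N, (C : 𝕜) * ∑ n ∈ Finset.range N, (((1 / 2) ^ n : ℝ) : 𝕜) * e' (p (y n)).2 =
      y' (i f) - (((1 / 2) ^ N : ℝ) : 𝕜) * (y N).1 (i f) := by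
    intro N
    induction N with
    | zero => simp [y]
    | succ N ih =>
      rw [Finset.sum_range_succ, mul_add, ih, hf _ (hpΓ _), hy]
      simp only [smul_apply, sub_apply, smul_eq_mul]
      push_cast
      ring
  have hbound : ∀ N, ‖(y N).1 (i f)‖ ≤ ‖f‖ + 1 := by
    intro N
    have h0 : 0 < ‖f‖ + 1 := by positivity
    have := (y N).2 _ ⟨(((‖f‖ + 1)⁻¹ : ℝ) : 𝕜) • f, by
      rw [mem_closedBall_zero_iff, norm_smul, RCLike.norm_of_nonneg (inv_nonneg.2 h0.le),
        inv_mul_le_iff₀ h0]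
      linarith, rfl⟩
    rwa [map_smul, map_smul, norm_smul, RCLike.norm_of_nonneg (inv_nonneg.2 h0.le),
      inv_mul_le_iff₀ h0, mul_one] at this
  have hlim : Filter.Tendsto (fun N => (((1 / 2) ^ N : ℝ) : 𝕜) * (y N).1 (i f)) Filter.atTop
      (nhds 0) := by
    refine squeeze_zero_norm (a := fun N => (1 / 2 : ℝ) ^ N * (‖f‖ + 1)) (fun N => ?_) ?_
    · rw [norm_mul, RCLike.norm_of_nonneg (by positivity)]
      exact mul_le_mul_of_nonneg_left (hbound N) (by positivity)
    · simpa using (tendsto_pow_atTop_nhds_zero_of_lt_one (r := (1 / 2 : ℝ)) (by norm_num)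
        (by norm_num)).mul_const (‖f‖ + 1)
  have h1 := (hx e').const_mul (C : 𝕜)
  simp only [hsum] at h1
  have h2 := tendsto_nhds_unique h1 (tendsto_const_nhds.sub hlim)
  rw [map_smul, smul_eq_mul, h2, sub_zero]

variable [PolynormableSpace 𝕜 E]

/-- If functionals `t` determine the norm of `X` up to a constant and the vectors `w` form a bounded
set, then the functionals in the polar of the unit ball of `X` are matched by vectors in a bounded
set, with respect to all `e'` and `f` which satisfy `e' ∘ w = t (f)`. -/
theorem exists_bounded_forall_exists_apply_eq [IsTopologicalAddGroup E] [ContinuousSMul 𝕜 E]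
    (hE : IsLocallyComplete 𝕜 E) (i : X →ₗ[𝕜] Y) (hB : IsCompact (i '' Metric.closedBall 0 1))
    {U : Type*} (t : U → Y →L[𝕜] 𝕜) {w : U → E} (hw : Bornology.IsVonNBounded 𝕜 (Set.range w))
    {C : ℝ} (hC : 0 < C) (htC : ∀ f : X, (∀ x, ‖t x (i f)‖ ≤ 1) → ‖f‖ ≤ C) :
    ∃ S : Set E, Bornology.IsVonNBounded 𝕜 S ∧ ∀ y' : Y →L[𝕜] 𝕜,
      (∀ b ∈ i '' Metric.closedBall 0 1, ‖y' b‖ ≤ 1) →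
        ∃ e ∈ S, ∀ (e' : E →L[𝕜] 𝕜) (f : X), (∀ x, e' (w x) = t x (i f)) → e' e = y' (i f) := by
  -- Adjoining `0` keeps the hulls nonempty when `U` is empty.
  set D : Set E := closedAbsConvexHull 𝕜 (insert 0 (Set.range w))
  have hD : AbsConvex 𝕜 D := absConvex_convexClosedHull
  have hbdd : Bornology.IsVonNBounded 𝕜 D := (hw.insert 0).closedAbsConvexHull
  -- Taking the hull of pairs gives functional and vector the same coefficients, so no map `t x ↦ w
  -- x` need be well defined.
  set Γ : Set ((Y →L[𝕜] 𝕜) × E) :=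
    absConvexHull 𝕜 (insert 0 (Set.range fun x => (t x, w x)))
  have hΓsub : insert 0 (Set.range fun x => (t x, w x)) ⊆ Γ := subset_absConvexHull
  have hΓD : Γ ⊆ (LinearMap.snd 𝕜 (Y →L[𝕜] 𝕜) E) ⁻¹' D := by
    refine absConvexHull_min ?_ (hD.linearMap_preimage (LinearMap.snd 𝕜 (Y →L[𝕜] 𝕜) E))
    rintro _ (rfl | ⟨x, rfl⟩)
    · exact subset_closedAbsConvexHull (Set.mem_insert _ _)
    · exact subset_closedAbsConvexHull (Set.mem_insert_of_mem _ ⟨x, rfl⟩)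
  refine ⟨(C : 𝕜) • (3 : 𝕜) • D, (hbdd.image
    ((C : 𝕜) • (3 : 𝕜) • ContinuousLinearMap.id 𝕜 E)).subset ?_, fun y' hy' => ?_⟩
  · rintro _ ⟨_, ⟨e, he, rfl⟩, rfl⟩
    exact ⟨e, he, rfl⟩
  · obtain ⟨e, he, h⟩ := exists_mem_smul_forall_apply_eq hE isClosed_closedAbsConvexHull hD hbdd
      i hB (Γ := Γ) absConvex_absConvexHull
      ⟨0, hΓsub (Set.mem_insert _ _)⟩ (fun p hp => hΓD hp) hC
      (fun f hf => htC f fun x => hf _ (hΓsub (Set.mem_insert_of_mem _ ⟨x, rfl⟩))) hy'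
    refine ⟨e, he, fun e' f hf => h e' f fun p hp => ?_⟩
    -- The identity is linear in the pair, so it passes from the generators to the hull.
    have hΓeq : Γ ⊆ {p | e' p.2 = p.1 (i f)} := by
      refine absConvexHull_min ?_ (absConvex_of_smul_add_smul_mem fun p hp q hq a b _ => ?_)
      · rintro _ (rfl | ⟨x, rfl⟩)
        · simp
        · exact hf x
      · simp only [Set.mem_ofPred_eq] at hp hq ⊢
        simp [hp, hq]
    exact hΓeq hp

end Factorization

/-! ### Continuity on `Y'_κ`. -/

section Kappa

variable {𝕜 : Type*} [RCLike 𝕜] {Y E : Type*} [AddCommGroup Y] [Module 𝕜 Y] [TopologicalSpace Y]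
  [AddCommGroup E] [Module 𝕜 E] [TopologicalSpace E] [IsTopologicalAddGroup E]

/-- A linear map on `Y'_κ` that is bounded on the polar of a compact disk is continuous. -/
theorem DualKappa.continuous_of_isVonNBounded_image_polar {B : Set Y} (hB : AbsConvex 𝕜 B)
    (hBc : IsCompact B) (u : DualKappa 𝕜 Y →ₗ[𝕜] E)
    (hu : Bornology.IsVonNBounded 𝕜 (u '' {y' : DualKappa 𝕜 Y | ∀ b ∈ B, ‖y' b‖ ≤ 1})) :
    Continuous u := by
  refine continuous_of_continuousAt_zero u ?_
  rw [ContinuousAt, map_zero]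
  intro V hV
  -- If `r • V` contains the image of the polar, then `u` maps the neighbourhood `{‖y'‖ ≤ 1 / r on
  -- B}` into `V`.
  obtain ⟨r, hr, h⟩ := (hu hV).exists_pos
  have hr' : (r : 𝕜) ≠ 0 := by exact_mod_cast hr.ne'
  have hV' := h (r : 𝕜) (by rw [RCLike.norm_of_nonneg hr.le])
  have hev := UniformConvergenceCLM.eventually_nhds_zero_mapsTo (RingHom.id 𝕜)
    (𝔖 := {K : Set Y | AbsConvex 𝕜 K ∧ IsCompact K}) ⟨hB, hBc⟩
    (Metric.closedBall_mem_nhds (0 : 𝕜) (inv_pos.2 hr))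
  refine Filter.mem_map.2 (Filter.mem_of_superset hev fun y' hy' => ?_)
  have hmem : u ((r : 𝕜) • y') ∈ u '' {y' : DualKappa 𝕜 Y | ∀ b ∈ B, ‖y' b‖ ≤ 1} := by
    refine ⟨_, fun b hb => ?_, rfl⟩
    have := hy' hb
    rw [mem_closedBall_zero_iff] at this
    rw [smul_apply, norm_smul, RCLike.norm_of_nonneg hr.le]
    calc r * ‖y' b‖ ≤ r * r⁻¹ := by gcongr
      _ = 1 := mul_inv_cancel₀ hr.ne'
  obtain ⟨v, hv, hvu⟩ := hV' hmem
  rw [map_smul] at hvu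
  have hvu' : v = u y' := smul_right_injective E hr' hvu
  change u y' ∈ V
  rwa [← hvu']

end Kappa

/-! ### The restriction map and the extension operator. -/

section Extension

variable {𝕜 : Type*} [RCLike 𝕜] {Ω ω : Type*} {E : Type*} [AddCommGroup E] [Module 𝕜 E]
  [TopologicalSpace E]
  {F : LcFunctionSpace 𝕜 Ω 𝕜} {TK : F.Elem →ₗ[𝕜] (ω → 𝕜)} {ν : ω → Set.Ioi (0 : ℝ)}

theorem WeightedSpace.absConvex_unitBall : AbsConvex 𝕜 (WeightedSpace.unitBall TK ν) :=
  absConvex_image_closedBall (WeightedSpace.incl TK ν)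

/-- The restriction map sends `F_ε ν(Ω, E)` to the `lb`-restriction space. -/
theorem mapsTo_restrictionMap {FE : LcFunctionSpace 𝕜 Ω E} (G : Submodule 𝕜 (E →L[𝕜] 𝕜))
    (hδ : HasContinuousEval F) {TE : FE.Elem →ₗ[𝕜] (ω → E)}
    (hcons : IsConsistentFamily hδ TE TK) (hstrong : IsStrongFamily TE TK) (U : Set ω) :
    Set.MapsTo (restrictionMap TE U) (epsWeightedSpace hδ TK ν FE)
      (lbRestrictionSpace TK ν U G) := by
  rintro h ⟨u, hu, huh⟩
  obtain ⟨hmem, hTE⟩ := hcons u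
  have hh : LcFunctionSpace.Elem.mk (epsMap hδ u) hmem = h := Subtype.ext huh
  rw [hh] at hTE
  have hweight : Bornology.IsVonNBounded 𝕜 (Set.range fun x : ω => ((ν x : ℝ) : 𝕜) • TE h x) := by
    refine hu.subset ?_
    rintro _ ⟨x, rfl⟩
    obtain ⟨hx, hux⟩ := hTE x
    refine ⟨((ν x : ℝ) : 𝕜) • DualKappa.mk (familyLinear TK x) hx, ?_, ?_⟩
    · rintro _ ⟨g, hg, rfl⟩
      rw [mem_closedBall_zero_iff] at hg
      rw [smul_apply, norm_smul, RCLike.norm_of_nonneg (ν x).2.le, mul_comm]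
      exact (le_ciSup (WeightedSpace.bddAbove g) x).trans hg
    · rw [map_smul]
      exact congrArg _ hux.symm
  refine ⟨fun e' _ => ?_, hweight.subset ?_⟩
  · obtain ⟨hf, hTK⟩ := hstrong e' h
    obtain ⟨M, hM⟩ := ((NormedSpace.isVonNBounded_iff 𝕜).1 (hweight.image e')).exists_norm_le
    refine ⟨(⟨LcFunctionSpace.Elem.mk (e' ∘ h.toFun) hf, M, ?_⟩ : weightedSubmodule TK ν),
      fun x => hTK x⟩
    rintro _ ⟨x, rfl⟩
    have := hM _ ⟨_, ⟨x, rfl⟩, rfl⟩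
    rw [map_smul, norm_smul, RCLike.norm_of_nonneg (ν x).2.le] at this
    change ‖TK (LcFunctionSpace.Elem.mk (e' ∘ h.toFun) hf) x‖ * (ν x : ℝ) ≤ M
    rwa [hTK, mul_comm]
  · rintro _ ⟨x, rfl⟩
    exact ⟨x, rfl⟩

variable [IsTopologicalAddGroup E] [ContinuousSMul 𝕜 E] [PolynormableSpace 𝕜 E]

/-- Each element of the polar of the unit ball of `Fν(Ω)` has a vector representing it, uniformly
in a bounded set. -/
theorem exists_bounded_representing_of_mem_unitBallPolar (hE : IsLocallyComplete 𝕜 E)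
    (G : Submodule 𝕜 (E →L[𝕜] 𝕜)) (hT : ∀ x, Continuous (familyLinear TK x))
    (hball : IsCompact (WeightedSpace.unitBall TK ν)) {U : Set ω}
    (hU : WeightedSpace.FixesTopology TK ν U) {f : U → E}
    (hf : f ∈ lbRestrictionSpace TK ν U G) :
    ∃ S : Set E, Bornology.IsVonNBounded 𝕜 S ∧ ∀ y' ∈ WeightedSpace.unitBallPolar TK ν,
      ∃ e ∈ S, ∀ (e' : E →L[𝕜] 𝕜) (g : WeightedSpace TK ν),
        (∀ x : U, TK (WeightedSpace.incl TK ν g) x = e' (f x)) →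
          e' e = y' (WeightedSpace.incl TK ν g) := by
  obtain ⟨C, hC, hUC⟩ := hU
  let t : U → (F.Elem →L[𝕜] 𝕜) := fun x => ((ν x : ℝ) : 𝕜) • ⟨familyLinear TK x, hT x⟩
  have ht : ∀ x (g : F.Elem), t x g = ((ν x : ℝ) : 𝕜) * TK g x := fun _ _ => rfl
  obtain ⟨S, hS, h⟩ := exists_bounded_forall_exists_apply_eq hE (WeightedSpace.incl TK ν) hball t
    hf.2 hC fun g hg => by
      refine (hUC g).trans (mul_le_of_le_one_right hC.le (Real.iSup_le (fun x => ?_) zero_le_one))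
      have := hg x
      rw [ht, norm_mul, RCLike.norm_of_nonneg (ν x).2.le] at this
      rwa [mul_comm]
  refine ⟨S, hS, fun y' hy' => ?_⟩
  obtain ⟨e, he, heq⟩ := h y' hy'
  refine ⟨e, he, fun e' g hg => heq e' g fun x => ?_⟩
  rw [ht, hg, map_smul, smul_eq_mul]

/-- Each function in the `lb`-restriction space extends to an operator in the `ε`-product that is
bounded on the polar of the unit ball. -/
theorem exists_epsProd_apply_eq (hE : IsLocallyComplete 𝕜 E)
    (G : Submodule 𝕜 (E →L[𝕜] 𝕜)) (hG : IsSeparating G)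
    (hT : ∀ x, Continuous (familyLinear TK x))
    (hball : IsCompact (WeightedSpace.unitBall TK ν)) {U : Set ω}
    (hU : WeightedSpace.FixesTopology TK ν U) {f : U → E}
    (hf : f ∈ lbRestrictionSpace TK ν U G) :
    ∃ u : EpsProd 𝕜 F.Elem E,
      Bornology.IsVonNBounded 𝕜 (u '' WeightedSpace.unitBallPolar TK ν) ∧
        ∀ x : U, u (DualKappa.mk (familyLinear TK x) (hT x)) = f x := by
  obtain ⟨S, hS, hSe⟩ := exists_bounded_representing_of_mem_unitBallPolar hE G hT hball hU hf
  -- The graph of the operator sought; quantifying over all admissible `g` avoids choosing `f_{e'}`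
  -- linearly in `e'`.
  let Rep : DualKappa 𝕜 F.Elem → E → Prop := fun y' e =>
    ∀ e' ∈ G, ∀ g : WeightedSpace TK ν,
      (∀ x : U, TK (WeightedSpace.incl TK ν g) x = e' (f x)) →
        e' e = y' (WeightedSpace.incl TK ν g)
  have huniq : ∀ y' e₁ e₂, Rep y' e₁ → Rep y' e₂ → e₁ = e₂ := by
    intro y' e₁ e₂ h₁ h₂
    rw [← sub_eq_zero]
    refine hG _ fun e' he' => ?_
    obtain ⟨g, hg⟩ := hf.1 e' he'
    rw [map_sub, h₁ e' he' g hg, h₂ e' he' g hg, sub_self]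
  have hsmul : ∀ (c : 𝕜) y' e, Rep y' e → Rep (c • y') (c • e) := by
    intro c y' e h e' he' g hg
    rw [map_smul, h e' he' g hg, smul_apply]
  have hadd : ∀ y₁ y₂ e₁ e₂, Rep y₁ e₁ → Rep y₂ e₂ → Rep (y₁ + y₂) (e₁ + e₂) := by
    intro y₁ y₂ e₁ e₂ h₁ h₂ e' he' g hg
    rw [map_add, h₁ e' he' g hg, h₂ e' he' g hg, add_apply]
  have hex : ∀ y', ∃ e, Rep y' e := by
    intro y'
    -- Every functional is bounded on the compact ball, so a positive multiple of it lies in the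
    -- polar.
    obtain ⟨r, hr⟩ := (hball.image (map_continuous y')).isBounded.exists_norm_le
    have h0 : 0 < |r| + 1 := by positivity
    obtain ⟨e, -, he⟩ := hSe ((((|r| + 1)⁻¹ : ℝ) : 𝕜) • y') fun b hb => by
      rw [smul_apply, norm_smul, RCLike.norm_of_nonneg (inv_nonneg.2 h0.le), inv_mul_le_iff₀ h0]
      have := hr _ ⟨b, hb, rfl⟩
      linarith [le_abs_self r]
    have := hsmul ((|r| + 1 : ℝ) : 𝕜) _ e fun e' _ g hg => he e' g hg
    rw [smul_smul, ← RCLike.ofReal_mul, mul_inv_cancel₀ h0.ne', RCLike.ofReal_one, one_smul] at this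
    exact ⟨_, this⟩
  choose φ hφ using hex
  let u : DualKappa 𝕜 F.Elem →ₗ[𝕜] E :=
    { toFun := φ
      map_add' := fun y₁ y₂ => huniq _ _ _ (hφ _) (hadd _ _ _ _ (hφ _) (hφ _))
      map_smul' := fun c y' => huniq _ _ _ (hφ _) (hsmul _ _ _ (hφ _)) }
  have hbdd : Bornology.IsVonNBounded 𝕜 (u '' WeightedSpace.unitBallPolar TK ν) := by
    refine hS.subset ?_
    rintro _ ⟨y', hy', rfl⟩
    obtain ⟨e, he, h⟩ := hSe y' hy'
    have : u y' = e := huniq y' _ _ (hφ y') fun e' _ g hg => h e' g hg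
    rwa [this]
  have hcont : Continuous u := DualKappa.continuous_of_isVonNBounded_image_polar
    WeightedSpace.absConvex_unitBall hball u hbdd
  refine ⟨UniformConvergenceCLM.ofFun _ _ _ ⟨u, hcont⟩, hbdd, fun x => ?_⟩
  -- By the defining property of `g`, the vector `f x` itself represents `T_x`.
  exact huniq _ _ _ (hφ _) fun e' _ g hg => (hg x).symm

end Extension

theorem mainTheorem2 {𝕜 : Type*} [RCLike 𝕜]
    {Ω ω : Type*} [Nonempty Ω] [Nonempty ω]
    {E : Type*} [AddCommGroup E] [Module 𝕜 E] [TopologicalSpace E] [IsTopologicalAddGroup E]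
    [ContinuousSMul 𝕜 E] [PolynormableSpace 𝕜 E] [T2Space E] [Nontrivial E]
    (hE : IsLocallyComplete 𝕜 E)
    (G : Submodule 𝕜 (E →L[𝕜] 𝕜)) (hG : IsSeparating G)
    (F : LcFunctionSpace 𝕜 Ω 𝕜) (FE : LcFunctionSpace 𝕜 Ω E)
    (hδ : HasContinuousEval F) (hcompat : IsEpsIntoCompatible hδ FE)
    (ν : ω → Set.Ioi (0 : ℝ))
    (TE : FE.Elem →ₗ[𝕜] (ω → E)) (TK : F.Elem →ₗ[𝕜] (ω → 𝕜))
    (hcons : IsConsistentFamily hδ TE TK) (hstrong : IsStrongFamily TE TK)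
    (hHaus : T2Space (WeightedSpace TK ν)) (hcomplete : CompleteSpace (WeightedSpace TK ν))
    (hball : IsCompact (WeightedSpace.unitBall TK ν))
    (U : Set ω) (hU : WeightedSpace.FixesTopology TK ν U) :
    ∃ hR : Set.MapsTo (restrictionMap TE U)
        (epsWeightedSpace hδ TK ν FE) (lbRestrictionSpace TK ν U G),
      Function.Surjective hR.restrict := by
  refine ⟨mapsTo_restrictionMap G hδ hcons hstrong U, ?_⟩
  rintro ⟨f, hf⟩
  -- Continuity of `T_x` is part of consistency and can be read off at the zero operator.
  have hT : ∀ x, Continuous (familyLinear TK x) := fun x => by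
    obtain ⟨_, h⟩ := hcons 0
    exact (h x).1
  obtain ⟨u, hu, huf⟩ := exists_epsProd_apply_eq hE G hG hT hball hU hf
  obtain ⟨hmem, hTE⟩ := hcons u
  refine ⟨⟨LcFunctionSpace.Elem.mk (epsMap hδ u) hmem, u, hu, rfl⟩, Subtype.ext (funext fun x => ?_)⟩
  obtain ⟨_, hux⟩ := hTE x
  exact hux.trans (huf x)
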